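/- Let $\mathcal N=\{1,\dots,N\}$ be a finite set of clients. Client $i$ has $n_i\ge 1$ data points, data distribution $\mathcal D_i$ (a probability measure on a sample space $Z$) and unit participation cost $c_i>0$. Put $\alpha_i=n_i/\sum_{j}n_j$. Let $\mathcal H$ be a reproducing kernel Hilbert space of real functions on $Z$ with kernel $k$, and assume that the kernel mean embeddings $\mu_i=\mathbb E_{z\sim\mathcal D_i}[k(\cdot,z)]\in\mathcal H$ exist (as Bochner integrals). For a participation profile $\boldsymbol x\in[0,1]^N$ with $\boldsymbol x\neq 0$ let $$\mu(\boldsymbol x)=\frac{\sum_{i}\alpha_i x_i\mu_i}{\sum_{i}\alpha_i x_i}.$$ At $\boldsymbol x=0$ this quotient is $0/0$, and $\mu(0)\in\mathcal H$ may be assigned any value, subject only to the following: if all $\mu_i$ are equal, then $\mu(0)$ is their common value (which is then the value of $\mu(\boldsymbol x)$ for every $\boldsymbol x\ne 0$). Let $\hat\lambda_q=\lambda_q C$ with $\lambda_q,C>0$. Given a payment scheme $\boldsymbol p=(p_1,\dots,p_N)\in\mathbb R_+^N$ of the server, consider the game in which each client $i$ chooses $x_i\in[0,1]$ and has the utility $$U_i(x_i;\boldsymbol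 x_{-i},p_i)=-\hat\lambda_q\,\|\mu(\boldsymbol x)-\mu_i\|_{\mathcal H}^2+p_ix_i-c_ix_i .$$ Then, for every payment scheme $\boldsymbol p\in\mathbb R_+^N$, this game has a Nash equilibrium in pure strategies: there is $\boldsymbol x^*\in[0,1]^N$ such that for every $i\in\mathcal N$ $$U_i(x_i^*;\boldsymbol x_{-i}^*,p_i)\ \ge\ U_i(x_i;\boldsymbol x_{-i}^*,p_i)\qquad\text{for all }x_i\in[0,1].$$ -/

import Mathlib

open MeasureTheory

noncomputable section

/-- The canonical feature map `z ↦ k(·, z)` of a reproducing kernel Hilbert space `H` of real-valued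
functions on `Z`, where `k` is the kernel of `H`. -/
def featureMap {Z : Type*} (H : Type*) [NormedAddCommGroup H] [InnerProductSpace ℝ H]
    [CompleteSpace H] [RKHS ℝ H Z ℝ] (z : Z) : H :=
  RKHS.kerFun H z 1

/-- The kernel mean embedding `𝔼_{z ∼ D} [k(·, z)]` of a distribution `D` on `Z`. -/
def kernelMeanEmbedding {Z : Type*} [MeasurableSpace Z] (H : Type*) [NormedAddCommGroup H]
    [InnerProductSpace ℝ H] [CompleteSpace H] [RKHS ℝ H Z ℝ] (D : Measure Z) : H :=
  ∫ z, featureMap H z ∂D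

/-- The weight `α i = n i / ∑ j, n j` of client `i`, where `n i` is its number of data points. -/
def clientWeight {N : ℕ} (n : Fin N → ℕ) (i : Fin N) : ℝ :=
  (n i : ℝ) / ∑ j, (n j : ℝ)

/-- The aggregated embedding `μ(x) = (∑ i, α i * x i • μ i) / ∑ i, α i * x i` of a participation
profile `x`. When the denominator is zero (nobody participates) the quotient is `0 / 0` and the
value is the vector `μ₀`. -/
def aggregatedEmbedding {N : ℕ} {H : Type*} [NormedAddCommGroup H] [InnerProductSpace ℝ H]
    (α : Fin N → ℝ) (μ : Fin N → H) (μ₀ : H) (x : Fin N → ℝ) : H :=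
  open Classical in
  if ∑ i, α i * x i = 0 then μ₀
  else (∑ i, α i * x i)⁻¹ • ∑ i, (α i * x i) • μ i

/-- The performance impact `u i (x) = lamHat * ‖μ(x) - μ i‖ ^ 2` on client `i`. -/
def performanceImpact {N : ℕ} {H : Type*} [NormedAddCommGroup H] [InnerProductSpace ℝ H]
    (α : Fin N → ℝ) (μ : Fin N → H) (μ₀ : H) (lamHat : ℝ) (i : Fin N) (x : Fin N → ℝ) : ℝ :=
  lamHat * ‖aggregatedEmbedding α μ μ₀ x - μ i‖ ^ 2

/-- The utility `U i (x) = - u i (x) + p i * x i - c i * x i` of client `i`. -/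
def clientUtility {N : ℕ} {H : Type*} [NormedAddCommGroup H] [InnerProductSpace ℝ H]
    (α : Fin N → ℝ) (μ : Fin N → H) (μ₀ : H) (lamHat : ℝ) (c p : Fin N → ℝ)
    (i : Fin N) (x : Fin N → ℝ) : ℝ :=
  -performanceImpact α μ μ₀ lamHat i x + p i * x i - c i * x i

/-- `x` is a (pure) Nash equilibrium of the game in which each player `i` chooses a level in
`[0, 1]` and has the payoff `U i`. -/
def IsNashEquilibrium {N : ℕ} (U : Fin N → (Fin N → ℝ) → ℝ) (x : Fin N → ℝ) : Prop :=
  (∀ i, x i ∈ Set.Icc (0 : ℝ) 1) ∧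
    ∀ i, ∀ t ∈ Set.Icc (0 : ℝ) 1, U i (Function.update x i t) ≤ U i x

end

open Set Filter Topology

/-! ### Weighted dispersion and its minimum at the barycentre. -/

section Dispersion

variable {N : ℕ} {H : Type*} [NormedAddCommGroup H]

/-! Let `S = ∑ j, α j * x j` and `β j = (c j - p j) / (2 * lamHat)`. For `S > 0` the first-order
condition of client `i` is `(t - x i) * (α i * ‖μ(x) - μ i‖ ^ 2 - β i * S) ≤ 0`. By an envelope
argument this is also the condition for `x` to maximize the dispersion about its own barycentre
minus `s * ∑ j, β j * x j`, with `s` held fixed at the value `S`.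

That dispersion is a minimum over `m` of functions linear in `x`, hence concave. The maximizers for
given `s` therefore form a convex set with closed graph in `s`, and a one-dimensional Kakutani
argument yields a maximizer whose total weight is exactly `s` (`exists_isMaxOn_sum_eq`).

Each utility is concave in the client's own level as long as the total weight is positive, so the
first-order condition suffices (`isNashEquilibrium_of_isMaxOn`). Total weight zero would force all
embeddings to coincide; the game then decouples and has dominant strategies. -/

/-- The weighted sum of squared distances `∑ j, α j * x j * ‖m - μ j‖ ^ 2` of the points `μ j`
from `m`. -/
def dispersion (α : Fin N → ℝ) (μ : Fin N → H) (x : Fin N → ℝ) (m : H) : ℝ :=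
  ∑ j, α j * x j * ‖m - μ j‖ ^ 2

theorem sum_apply_update {E : Type*} [AddCommGroup E] (g : Fin N → ℝ → E) (x : Fin N → ℝ)
    (i : Fin N) (t : ℝ) :
    ∑ j, g j (Function.update x i t j) = ∑ j, g j (x j) + (g i t - g i (x i)) := by
  rw [← sub_eq_iff_eq_add', ← Finset.sum_sub_distrib, Finset.sum_eq_single i]
  · simp
  · intro j _ hj
    simp [hj]
  · simp

theorem sum_mul_update (a x : Fin N → ℝ) (i : Fin N) (t : ℝ) :
    ∑ j, a j * Function.update x i t j = ∑ j, a j * x j + a i * (t - x i) := by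
  rw [sum_apply_update (fun j s => a j * s)]
  ring

theorem dispersion_update (α : Fin N → ℝ) (μ : Fin N → H) (x : Fin N → ℝ) (m : H) (i : Fin N)
    (t : ℝ) :
    dispersion α μ (Function.update x i t) m
      = dispersion α μ x m + α i * (t - x i) * ‖m - μ i‖ ^ 2 := by
  unfold dispersion
  rw [sum_apply_update (fun j s => α j * s * ‖m - μ j‖ ^ 2)]
  ring

theorem dispersion_add_smul (α : Fin N → ℝ) (μ : Fin N → H) (x y : Fin N → ℝ) (a b : ℝ) (m : H) :
    dispersion α μ (a • x + b • y) m = a * dispersion α μ x m + b * dispersion α μ y m := by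
  simp only [dispersion, Finset.mul_sum, ← Finset.sum_add_distrib, Pi.add_apply, Pi.smul_apply,
    smul_eq_mul]
  exact Finset.sum_congr rfl fun j _ => by ring

theorem continuous_dispersion (α : Fin N → ℝ) (μ : Fin N → H) (m : H) :
    Continuous fun x => dispersion α μ x m := by
  unfold dispersion
  fun_prop

variable {α : Fin N → ℝ} {μ : Fin N → H} {x : Fin N → ℝ}

theorem mul_eq_zero_of_sum_eq_zero (hα : ∀ j, 0 < α j) (hx : ∀ j, 0 ≤ x j)
    (h : ∑ j, α j * x j = 0) (j : Fin N) : α j * x j = 0 :=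
  (Finset.sum_eq_zero_iff_of_nonneg fun j _ => mul_nonneg (hα j).le (hx j)).1 h j
    (Finset.mem_univ j)

theorem dispersion_eq_zero (hα : ∀ j, 0 < α j) (hx : ∀ j, 0 ≤ x j)
    (h : ∑ j, α j * x j = 0) (m : H) : dispersion α μ x m = 0 :=
  Finset.sum_eq_zero fun j _ => by rw [mul_eq_zero_of_sum_eq_zero hα hx h j, zero_mul]

variable [InnerProductSpace ℝ H] {μ₀ : H}

/-- The dispersion around the aggregated embedding, penalized by the linear term
`s * ∑ j, β j * x j`. -/
noncomputable def penalizedDispersion (α β : Fin N → ℝ) (μ : Fin N → H) (μ₀ : H) (s : ℝ) (x : Fin N → ℝ) : ℝ :=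
  dispersion α μ x (aggregatedEmbedding α μ μ₀ x) - s * ∑ j, β j * x j

theorem sum_smul_aggregatedEmbedding (h : ∑ j, α j * x j ≠ 0) :
    (∑ j, α j * x j) • aggregatedEmbedding α μ μ₀ x = ∑ j, (α j * x j) • μ j := by
  rw [aggregatedEmbedding, if_neg h, smul_inv_smul₀ h]

/-- Huygens–Steiner: in the expansion about the barycentre the cross terms cancel, since the
weighted deviations from it sum to zero. -/
theorem dispersion_eq_add (h : ∑ j, α j * x j ≠ 0) (m : H) :
    dispersion α μ x m = dispersion α μ x (aggregatedEmbedding α μ μ₀ x)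
      + (∑ j, α j * x j) * ‖m - aggregatedEmbedding α μ μ₀ x‖ ^ 2 := by
  have key := sum_smul_aggregatedEmbedding (μ := μ) (μ₀ := μ₀) h
  set b := aggregatedEmbedding α μ μ₀ x
  have hzero : ∑ j, α j * x j * inner ℝ (m - b) (b - μ j) = 0 := by
    simp only [← inner_smul_right_eq_smul, ← smul_eq_mul (a := α _ * x _)]
    rw [← inner_sum]
    simp only [smul_sub, Finset.sum_sub_distrib]
    rw [← Finset.sum_smul, key, sub_self, inner_zero_right]
  have hj (j : Fin N) : α j * x j * ‖m - μ j‖ ^ 2 = α j * x j * ‖b - μ j‖ ^ 2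
      + α j * x j * ‖m - b‖ ^ 2 + 2 * (α j * x j * inner ℝ (m - b) (b - μ j)) := by
    rw [← sub_add_sub_cancel m b (μ j), norm_add_sq_real]
    ring
  unfold dispersion
  rw [Finset.sum_congr rfl fun j _ => hj j, Finset.sum_add_distrib, Finset.sum_add_distrib,
    ← Finset.mul_sum, hzero, Finset.sum_mul]
  ring

theorem dispersion_aggregatedEmbedding_le (hα : ∀ j, 0 < α j) (hx : ∀ j, 0 ≤ x j) (m : H) :
    dispersion α μ x (aggregatedEmbedding α μ μ₀ x) ≤ dispersion α μ x m := by
  by_cases h : ∑ j, α j * x j = 0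
  · rw [dispersion_eq_zero hα hx h, dispersion_eq_zero hα hx h]
  · rw [dispersion_eq_add (μ₀ := μ₀) h m]
    have : 0 ≤ ∑ j, α j * x j := Finset.sum_nonneg fun j _ => mul_nonneg (hα j).le (hx j)
    exact le_add_of_nonneg_right (by positivity)

/-- The vector `(∑ j, α j * x j) • (μ(x) - μ i)` does not involve `x i`, so a deviation of client
`i` only rescales `μ(x) - μ i`. -/
theorem aggregatedEmbedding_update_sub {i : Fin N} {t : ℝ} (h : ∑ j, α j * x j ≠ 0)
    (h' : ∑ j, α j * x j + α i * (t - x i) ≠ 0) :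
    aggregatedEmbedding α μ μ₀ (Function.update x i t) - μ i
      = ((∑ j, α j * x j) / (∑ j, α j * x j + α i * (t - x i))) •
        (aggregatedEmbedding α μ μ₀ x - μ i) := by
  have hu := sum_mul_update α x i t
  have key := sum_smul_aggregatedEmbedding (μ := μ) (μ₀ := μ₀) h
  have key' := sum_smul_aggregatedEmbedding (μ := μ) (μ₀ := μ₀) (hu ▸ h')
  rw [sum_apply_update (fun j s => (α j * s) • μ j), ← key, hu] at key'
  rw [div_eq_inv_mul, mul_smul, eq_inv_smul_iff₀ h', smul_sub, key', smul_sub]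
  module

end Dispersion

/-! ### Maximizers of the penalized dispersion and the fixed point in `s`. -/

section Equilibrium

variable {N : ℕ} {H : Type*} [NormedAddCommGroup H] [InnerProductSpace ℝ H]
  {α β : Fin N → ℝ} {μ : Fin N → H} {μ₀ : H}

theorem penalizedDispersion_le (hα : ∀ j, 0 < α j) {x : Fin N → ℝ} (hx : 0 ≤ x) (s : ℝ) (m : H) :
    penalizedDispersion α β μ μ₀ s x ≤ dispersion α μ x m - s * ∑ j, β j * x j :=
  sub_le_sub_right (dispersion_aggregatedEmbedding_le hα hx m) _

theorem concaveOn_penalizedDispersion (hα : ∀ j, 0 < α j) (s : ℝ) :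
    ConcaveOn ℝ (Icc (0 : Fin N → ℝ) 1) (penalizedDispersion α β μ μ₀ s) := by
  refine ⟨convex_Icc 0 1, fun x hx y hy a b ha hb _ => ?_⟩
  set m := aggregatedEmbedding α μ μ₀ (a • x + b • y) with hm
  have h1 := penalizedDispersion_le (β := β) (μ := μ) (μ₀ := μ₀) hα hx.1 s m
  have h2 := penalizedDispersion_le (β := β) (μ := μ) (μ₀ := μ₀) hα hy.1 s m
  have hlin : ∑ j, β j * (a • x + b • y) j = a * ∑ j, β j * x j + b * ∑ j, β j * y j := by
    simp only [Finset.mul_sum, ← Finset.sum_add_distrib, Pi.add_apply, Pi.smul_apply, smul_eq_mul]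
    exact Finset.sum_congr rfl fun j _ => by ring
  rw [smul_eq_mul, smul_eq_mul]
  conv_rhs => rw [penalizedDispersion, ← hm, dispersion_add_smul, hlin]
  linarith [mul_le_mul_of_nonneg_left h1 ha, mul_le_mul_of_nonneg_left h2 hb]

theorem exists_isMaxOn_penalizedDispersion (hα : ∀ j, 0 < α j) (s : ℝ) :
    ∃ x ∈ Icc (0 : Fin N → ℝ) 1, IsMaxOn (penalizedDispersion α β μ μ₀ s) (Icc 0 1) x := by
  refine UpperSemicontinuousOn.exists_isMaxOn ⟨0, left_mem_Icc.2 zero_le_one⟩ isCompact_Icc ?_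
  intro x _ c hc
  -- Freezing `m` at the barycentre of `x` gives a continuous majorant that is exact at `x`. This
  -- works even at the zero profile, where the aggregated embedding may jump.
  have hcont : Continuous fun y : Fin N → ℝ =>
      dispersion α μ y (aggregatedEmbedding α μ μ₀ x) - s * ∑ j, β j * y j :=
    (continuous_dispersion α μ _).sub (by fun_prop)
  filter_upwards [self_mem_nhdsWithin,
    nhdsWithin_le_nhds (hcont.continuousAt.eventually_lt_const hc)] with y hy hyc
  exact (penalizedDispersion_le hα hy.1 s _).trans_lt hyc

/-- As the dispersion is a minimum over `m`, maximality is a family of weak inequalities between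
functions continuous in `(s, x)`. -/
theorem isClosed_isMaxOn_penalizedDispersion (hα : ∀ j, 0 < α j) :
    IsClosed {q : ℝ × (Fin N → ℝ) |
      q.2 ∈ Icc 0 1 ∧ IsMaxOn (penalizedDispersion α β μ μ₀ q.1) (Icc 0 1) q.2} := by
  have : {q : ℝ × (Fin N → ℝ) |
      q.2 ∈ Icc 0 1 ∧ IsMaxOn (penalizedDispersion α β μ μ₀ q.1) (Icc 0 1) q.2}
      = {q | q.2 ∈ Icc 0 1} ∩ ⋂ y ∈ Icc (0 : Fin N → ℝ) 1, ⋂ m : H,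
        {q | penalizedDispersion α β μ μ₀ q.1 y ≤ dispersion α μ q.2 m - q.1 * ∑ j, β j * q.2 j} := by
    ext q
    simp only [mem_ofPred_eq, mem_inter_iff, mem_iInter, isMaxOn_iff]
    refine and_congr_right fun hq => ⟨fun h y hy m => (h y hy).trans
      (penalizedDispersion_le hα hq.1 _ _), fun h y hy => h y hy _⟩
  rw [this]
  refine (isClosed_Icc.preimage continuous_snd).inter
    (isClosed_biInter fun y _ => isClosed_iInter fun m => isClosed_le ?_ ?_)
  · unfold penalizedDispersion
    fun_prop
  · exact ((continuous_dispersion α μ m).comp continuous_snd).sub (by fun_prop)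

/-- The `s` having a maximizer of weight at least `s`, and those having one of weight at most `s`,
form two nonempty closed sets covering an interval, so they meet. At a common `s`, the segment
joining the two maximizers consists of maximizers, and the weight takes the value `s` on it. -/
theorem exists_isMaxOn_sum_eq (hα : ∀ j, 0 < α j) :
    ∃ x ∈ Icc (0 : Fin N → ℝ) 1,
      IsMaxOn (penalizedDispersion α β μ μ₀ (∑ j, α j * x j)) (Icc 0 1) x := by
  set G := {q : ℝ × (Fin N → ℝ) |
    q.2 ∈ Icc 0 1 ∧ IsMaxOn (penalizedDispersion α β μ μ₀ q.1) (Icc 0 1) q.2}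
  have hG : IsClosed G := isClosed_isMaxOn_penalizedDispersion hα
  have hcompact : IsCompact (Icc 0 (∑ j, α j) ×ˢ Icc (0 : Fin N → ℝ) 1) :=
    isCompact_Icc.prod isCompact_Icc
  have hsum : Continuous fun q : ℝ × (Fin N → ℝ) => ∑ j, α j * q.2 j := by fun_prop
  have hproj (R : Set (ℝ × (Fin N → ℝ))) (hR : IsClosed R) :
      IsClosed (Prod.fst '' ((Icc 0 (∑ j, α j) ×ˢ Icc (0 : Fin N → ℝ) 1) ∩ (G ∩ R))) :=
    ((hcompact.inter_right (hG.inter hR)).image continuous_fst).isClosed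
  have hB : 0 ≤ ∑ j, α j := Finset.sum_nonneg fun j _ => (hα j).le
  have hA0 {x : Fin N → ℝ} (hx : x ∈ Icc 0 1) : 0 ≤ ∑ j, α j * x j :=
    Finset.sum_nonneg fun j _ => mul_nonneg (hα j).le (hx.1 j)
  have hA1 {x : Fin N → ℝ} (hx : x ∈ Icc 0 1) : ∑ j, α j * x j ≤ ∑ j, α j :=
    Finset.sum_le_sum fun j _ => mul_le_of_le_one_right (hα j).le (hx.2 j)
  have hmax (s : ℝ) := exists_isMaxOn_penalizedDispersion (β := β) (μ := μ) (μ₀ := μ₀) hα s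
  obtain ⟨s, -, ⟨⟨s₁, x⟩, ⟨-, ⟨hx, hxmax⟩, hxs⟩, rfl⟩, ⟨⟨s₂, y⟩, ⟨-, ⟨hy, hymax⟩, hys⟩, rfl⟩⟩ :=
    isPreconnected_closed_iff.1 (isPreconnected_Icc (a := 0) (b := ∑ j, α j)) _ _
      (hproj _ (isClosed_le continuous_fst hsum)) (hproj _ (isClosed_le hsum continuous_fst))
      (fun s hs => by
        obtain ⟨x, hx, hxmax⟩ := hmax s
        exact (le_total s (∑ j, α j * x j)).imp
          (fun h => ⟨(s, x), ⟨⟨hs, hx⟩, ⟨hx, hxmax⟩, h⟩, rfl⟩)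
          (fun h => ⟨(s, x), ⟨⟨hs, hx⟩, ⟨hx, hxmax⟩, h⟩, rfl⟩))
      (by
        obtain ⟨x, hx, hxmax⟩ := hmax 0
        exact ⟨0, left_mem_Icc.2 hB,
          ⟨(0, x), ⟨⟨left_mem_Icc.2 hB, hx⟩, ⟨hx, hxmax⟩, hA0 hx⟩, rfl⟩⟩)
      (by
        obtain ⟨x, hx, hxmax⟩ := hmax (∑ j, α j)
        exact ⟨∑ j, α j, right_mem_Icc.2 hB,
          ⟨(∑ j, α j, x), ⟨⟨right_mem_Icc.2 hB, hx⟩, ⟨hx, hxmax⟩, hA1 hx⟩, rfl⟩⟩)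
  simp only [mem_ofPred_eq] at hx hy hxmax hymax hxs hys
  have hpath : Continuous fun θ : ℝ => ∑ j, α j * ((1 - θ) • x + θ • y) j := by
    simp only [Pi.add_apply, Pi.smul_apply, smul_eq_mul]
    fun_prop
  obtain ⟨θ, hθ, hθs⟩ : s₂ ∈ (fun θ : ℝ => ∑ j, α j * ((1 - θ) • x + θ • y) j) '' Icc 0 1 :=
    intermediate_value_Icc' zero_le_one hpath.continuousOn (by simpa using ⟨hys, hxs⟩)
  have hz := convex_Icc (0 : Fin N → ℝ) 1 hx hy (sub_nonneg.2 hθ.2) hθ.1 (sub_add_cancel 1 θ)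
  refine ⟨_, hz, ?_⟩
  simp only [] at hθs
  rw [hθs]
  intro w hw
  have hconc := (concaveOn_penalizedDispersion (β := β) (μ := μ) (μ₀ := μ₀) hα s₂).2 hx hy
    (sub_nonneg.2 hθ.2) hθ.1 (sub_add_cancel 1 θ)
  rw [smul_eq_mul, smul_eq_mul] at hconc
  have h1 := mul_le_mul_of_nonneg_left (isMaxOn_iff.1 hxmax w hw) (sub_nonneg.2 hθ.2)
  have h2 := mul_le_mul_of_nonneg_left (isMaxOn_iff.1 hymax w hw) hθ.1
  simp only [mem_ofPred_eq]
  linarith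

/-! ### From maximizers to best responses. -/

theorem update_mem_Icc {x : Fin N → ℝ} (hx : x ∈ Icc 0 1) (i : Fin N) {t : ℝ}
    (ht : t ∈ Icc (0 : ℝ) 1) : Function.update x i t ∈ Icc 0 1 :=
  ⟨le_update_iff.2 ⟨ht.1, fun j _ => hx.1 j⟩,
    update_le_iff.2 ⟨ht.2, fun j _ => hx.2 j⟩⟩

/-- First-order condition for a maximizer of the penalized dispersion. -/
theorem variational_inequality (hα : ∀ j, 0 < α j) {x : Fin N → ℝ} (hx : x ∈ Icc 0 1)
    (hpos : 0 < ∑ j, α j * x j)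
    (hmax : IsMaxOn (penalizedDispersion α β μ μ₀ (∑ j, α j * x j)) (Icc 0 1) x)
    (i : Fin N) {t : ℝ} (ht : t ∈ Icc (0 : ℝ) 1) :
    (t - x i) * (α i * ‖aggregatedEmbedding α μ μ₀ x - μ i‖ ^ 2 - β i * ∑ j, α j * x j) ≤ 0 := by
  set S := ∑ j, α j * x j with hS
  set r := ‖aggregatedEmbedding α μ μ₀ x - μ i‖
  have hSt : 0 ≤ S + α i * (t - x i) := by
    rw [hS, ← sum_mul_update]
    exact Finset.sum_nonneg fun j _ => mul_nonneg (hα j).le ((update_mem_Icc hx i ht).1 j)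
  -- Instead of differentiating the minimum, `x` and the perturbed profile are compared with `m`
  -- frozen at the perturbed barycentre. The difference is linear in `θ`, so `θ` divides out before
  -- it tends to `0`.
  have hstep : ∀ θ ∈ Ioo (0 : ℝ) 1,
      (t - x i) * (α i * (S / (S + θ * (α i * (t - x i))) * r) ^ 2 - β i * S) ≤ 0 := by
    intro θ hθ
    have hSθ : 0 < S + θ * (α i * (t - x i)) := by
      nlinarith [mul_pos (sub_pos.2 hθ.2) hpos, mul_nonneg hθ.1.le hSt]
    have hmem : x i + θ * (t - x i) ∈ Icc (0 : ℝ) 1 := by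
      have := convex_Icc (0 : ℝ) 1 ⟨hx.1 i, hx.2 i⟩ ht (sub_nonneg.2 hθ.2.le) hθ.1.le
        (sub_add_cancel 1 θ)
      convert this using 1
      simp only [smul_eq_mul]
      ring
    have hα' : α i * (x i + θ * (t - x i) - x i) = θ * (α i * (t - x i)) := by ring
    have hle := isMaxOn_iff.1 hmax _ (update_mem_Icc hx i hmem)
    set m := aggregatedEmbedding α μ μ₀ (Function.update x i (x i + θ * (t - x i))) with hm
    have hnorm : ‖m - μ i‖ = S / (S + θ * (α i * (t - x i))) * r := by
      rw [hm, aggregatedEmbedding_update_sub hpos.ne' (by rw [hα']; exact hSθ.ne'), hα', norm_smul,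
        Real.norm_of_nonneg (div_nonneg hpos.le hSθ.le)]
    have hlow := hle.trans (penalizedDispersion_le hα hx.1 S m)
    rw [penalizedDispersion, ← hm, dispersion_update, sum_mul_update, hα', hnorm] at hlow
    refine nonpos_of_mul_nonpos_right (a := θ) ?_ hθ.1
    linarith
  have hcont : ContinuousAt (fun θ : ℝ =>
      (t - x i) * (α i * (S / (S + θ * (α i * (t - x i))) * r) ^ 2 - β i * S)) 0 := by
    have : S + 0 * (α i * (t - x i)) ≠ 0 := by simpa using hpos.ne'
    fun_prop (disch := assumption)
  have hlim := hcont.tendsto.mono_left (nhdsWithin_le_nhds (s := Ioi 0))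
  have := le_of_tendsto hlim (eventually_of_mem (Ioo_mem_nhdsGT one_pos) hstep)
  simpa [div_self hpos.ne'] using this

theorem isNashEquilibrium_of_isMaxOn (hα : ∀ j, 0 < α j) {lamHat : ℝ} (hlam : 0 < lamHat)
    {c p x : Fin N → ℝ} (hx : x ∈ Icc 0 1) (hpos : 0 < ∑ j, α j * x j)
    (hmax : IsMaxOn (penalizedDispersion α (fun j => (c j - p j) / (2 * lamHat)) μ μ₀
      (∑ j, α j * x j)) (Icc 0 1) x) :
    IsNashEquilibrium (clientUtility α μ μ₀ lamHat c p) x := by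
  refine ⟨fun i => ⟨hx.1 i, hx.2 i⟩, fun i t ht => ?_⟩
  have hvi := variational_inequality hα hx hpos hmax i ht
  have hnonneg : ∀ j, 0 ≤ Function.update x i t j := (update_mem_Icc hx i ht).1
  have hu := sum_mul_update α x i t
  simp only [clientUtility, performanceImpact, Function.update_self]
  set S := ∑ j, α j * x j with hS
  set r := ‖aggregatedEmbedding α μ μ₀ x - μ i‖ with hr
  obtain ⟨b, hb⟩ : ∃ b, b = (c i - p i) / (2 * lamHat) := ⟨_, rfl⟩
  have hp : p i = c i - 2 * lamHat * b := by
    rw [hb]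
    field_simp
    ring
  rw [← hb] at hvi
  by_cases h : S + α i * (t - x i) = 0
  -- The deviation empties the game, so client `i` was the only participant and `r = 0`. Its utility
  -- was `-2 * lamHat * b * x i`, which is nonnegative by `hvi`, while the zero profile pays at most
  -- `0` whatever `μ₀` is.
  · have hz := mul_eq_zero_of_sum_eq_zero hα hnonneg (hu.trans h)
    have hother (j : Fin N) (hj : j ≠ i) : x j = 0 := by
      simpa [hj, (hα j).ne'] using hz j
    have ht0 : t = 0 := by simpa [(hα i).ne'] using hz i
    have hSi : S = α i * x i :=
      Finset.sum_eq_single i (fun j _ hj => by rw [hother j hj, mul_zero]) (by simp)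
    have hr0 : r = 0 := by
      rw [hr, norm_eq_zero, sub_eq_zero]
      have key := sum_smul_aggregatedEmbedding (μ := μ) (μ₀ := μ₀) hpos.ne'
      rw [Finset.sum_eq_single (f := fun j => (α j * x j) • μ j) i
        (fun j _ hj => by simp [hother j hj]) (by simp), ← hS, hSi] at key
      exact smul_right_injective H (hSi ▸ hpos.ne') key
    have hbx : b * x i ≤ 0 := by
      rw [hr0, ht0] at hvi
      exact nonpos_of_mul_nonpos_left (b := S) (by linarith) hpos
    have := mul_nonneg hlam.le
      (sq_nonneg ‖aggregatedEmbedding α μ μ₀ (Function.update x i t) - μ i‖)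
    rw [ht0] at this ⊢
    rw [hr0, hp]
    nlinarith [mul_nonneg hlam.le (neg_nonneg.2 hbx)]
  · have hSw : 0 < S + α i * (t - x i) := by
      refine lt_of_le_of_ne ?_ (Ne.symm h)
      rw [← hu]
      exact Finset.sum_nonneg fun j _ => mul_nonneg (hα j).le (hnonneg j)
    rw [aggregatedEmbedding_update_sub hpos.ne' h, norm_smul,
      Real.norm_of_nonneg (div_nonneg hpos.le hSw.le), ← hr]
    set v := S / (S + α i * (t - x i)) with hv
    have hv0 : 0 < v := div_pos hpos hSw
    have hvinv : α i * (t - x i) / S = v⁻¹ - 1 := by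
      rw [hv, inv_div, add_div, div_self hpos.ne']
      ring
    -- Tangent-line bound at `w = 1` for the concave function `-1 / w ^ 2`, where `w = v⁻¹` is the
    -- ratio of the new total weight to the old.
    have hconv : 1 - v ^ 2 ≤ 2 * (α i * (t - x i) / S) := by
      rw [hvinv]
      have : v ^ 2 + 2 * v⁻¹ - 3 = (v - 1) ^ 2 * (v + 2) * v⁻¹ := by
        field_simp
        ring
      have : 0 ≤ (v - 1) ^ 2 * (v + 2) * v⁻¹ := by positivity
      linarith
    have hb' : α i * (t - x i) / S * r ^ 2 ≤ b * (t - x i) := by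
      rw [div_mul_eq_mul_div, div_le_iff₀ hpos]
      linarith
    have hgain : r ^ 2 - (v * r) ^ 2 ≤ 2 * (b * (t - x i)) := by
      nlinarith [mul_le_mul_of_nonneg_right hconv (sq_nonneg r)]
    rw [hp]
    nlinarith [mul_le_mul_of_nonneg_left hgain hlam.le]

/-- At total weight zero the penalty vanishes and the maximal dispersion is `0`. Full participation
then has dispersion zero, so every `μ i` equals its barycentre. -/
theorem sum_mul_pos_of_isMaxOn (hα : ∀ j, 0 < α j) {x : Fin N → ℝ} (hx : x ∈ Icc 0 1)
    (hmax : IsMaxOn (penalizedDispersion α β μ μ₀ (∑ j, α j * x j)) (Icc 0 1) x)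
    (hμ : ¬ ∃ ν, ∀ i, μ i = ν) : 0 < ∑ j, α j * x j := by
  refine (Finset.sum_nonneg fun j _ => mul_nonneg (hα j).le (hx.1 j)).lt_of_ne fun h => hμ ?_
  have hle := isMaxOn_iff.1 hmax 1 (right_mem_Icc.2 zero_le_one)
  rw [← h, penalizedDispersion, penalizedDispersion, dispersion_eq_zero hα hx.1 h.symm, zero_mul,
    zero_mul, sub_zero, sub_zero] at hle
  refine ⟨aggregatedEmbedding α μ μ₀ 1, fun i => ?_⟩
  have hterm (j : Fin N) : 0 ≤ α j * (1 : Fin N → ℝ) j *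
      ‖aggregatedEmbedding α μ μ₀ 1 - μ j‖ ^ 2 :=
    mul_nonneg (mul_nonneg (hα j).le zero_le_one) (sq_nonneg _)
  have := (Finset.sum_eq_zero_iff_of_nonneg fun j _ => hterm j).1
    (hle.antisymm (Finset.sum_nonneg fun j _ => hterm j)) i (Finset.mem_univ i)
  simpa [(hα i).ne', sub_eq_zero, eq_comm (a := μ i)] using this

/-! ### Equal embeddings, and the conclusion. -/

theorem aggregatedEmbedding_const (ν : H) (x : Fin N → ℝ) :
    aggregatedEmbedding α (fun _ => ν) ν x = ν := by
  by_cases h : ∑ j, α j * x j = 0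
  · rw [aggregatedEmbedding, if_pos h]
  · rw [aggregatedEmbedding, if_neg h, ← Finset.sum_smul, inv_smul_smul₀ h]

theorem exists_isNashEquilibrium_of_const (ν : H) (lamHat : ℝ) (c p : Fin N → ℝ) :
    ∃ x, IsNashEquilibrium (clientUtility α (fun _ => ν) ν lamHat c p) x := by
  refine ⟨fun i => if c i ≤ p i then 1 else 0, fun i => ?_, fun i t ht => ?_⟩
  · dsimp only
    split_ifs <;> simp
  · simp only [clientUtility, performanceImpact, aggregatedEmbedding_const, Function.update_self]
    split_ifs with h
    · nlinarith [mul_nonneg (sub_nonneg.2 h) (sub_nonneg.2 ht.2)]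
    · nlinarith [mul_nonneg (sub_nonneg.2 (not_le.1 h).le) ht.1]

theorem exists_isNashEquilibrium (hα : ∀ j, 0 < α j) {lamHat : ℝ} (hlam : 0 < lamHat)
    (c p : Fin N → ℝ) (hμ₀ : ∀ ν, (∀ i, μ i = ν) → μ₀ = ν) :
    ∃ x, IsNashEquilibrium (clientUtility α μ μ₀ lamHat c p) x := by
  by_cases hμ : ∃ ν, ∀ i, μ i = ν
  · obtain ⟨ν, hν⟩ := hμ
    obtain rfl := hμ₀ ν hν
    obtain rfl : μ = fun _ => μ₀ := funext hν
    exact exists_isNashEquilibrium_of_const μ₀ lamHat c p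
  · obtain ⟨x, hx, hmax⟩ := exists_isMaxOn_sum_eq (β := fun j => (c j - p j) / (2 * lamHat))
      (μ := μ) (μ₀ := μ₀) hα
    exact ⟨x, isNashEquilibrium_of_isMaxOn hα hlam hx (sum_mul_pos_of_isMaxOn hα hx hmax hμ) hmax⟩

end Equilibrium

theorem clientWeight_pos {N : ℕ} {n : Fin N → ℕ} (hn : ∀ i, 0 < n i) (i : Fin N) :
    0 < clientWeight n i :=
  div_pos (Nat.cast_pos.2 (hn i))
    (Finset.sum_pos (fun j _ => Nat.cast_pos.2 (hn j)) ⟨i, Finset.mem_univ i⟩)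

/-- `D i` and `n i` are the data distribution and the number of data points of client `i`, `c` the
participation costs, `lam * C` the coefficient of the performance impact, `p` the payment scheme.
The aggregated embedding of the zero profile is a `0 / 0`; its value `μ₀` is arbitrary, except that
it is the common embedding of the clients if all of them have the same one. -/
theorem mainTheorem3 {Z : Type*} [MeasurableSpace Z]
    {H : Type*} [NormedAddCommGroup H] [InnerProductSpace ℝ H] [CompleteSpace H] [RKHS ℝ H Z ℝ]
    {N : ℕ} (D : Fin N → Measure Z) [∀ i, IsProbabilityMeasure (D i)]
    (hD : ∀ i, Integrable (featureMap H) (D i))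
    (n : Fin N → ℕ) (hn : ∀ i, 0 < n i)
    (lam C : ℝ) (hlam : 0 < lam) (hC : 0 < C)
    (c : Fin N → ℝ) (hc : ∀ i, 0 < c i)
    (μ₀ : H) (hμ₀ : ∀ ν : H, (∀ i, kernelMeanEmbedding H (D i) = ν) → μ₀ = ν)
    (p : Fin N → ℝ) (hp : ∀ i, 0 ≤ p i) :
    ∃ x : Fin N → ℝ, IsNashEquilibrium
      (clientUtility (clientWeight n) (fun i => kernelMeanEmbedding H (D i)) μ₀ (lam * C) c p) x :=
  exists_isNashEquilibrium (clientWeight_pos hn) (mul_pos hlam hC) c p hμ₀
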